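/- Let $b,d\ge 3$ be integers, $n=4(b+d)$, and let $$\mathrm{Br}_n=\langle \sigma_1,\dots,\sigma_{n-1}\mid \sigma_i\sigma_j=\sigma_j\sigma_i\ (|i-j|>1),\ \sigma_i\sigma_{i+1}\sigma_i=\sigma_{i+1}\sigma_i\sigma_{i+1},\ \sigma_1\cdots\sigma_{n-1}\sigma_{n-1}\cdots\sigma_1=1\rangle$$ be the braid group of the sphere with $n$ marked points. Place the marked points in the plane on two horizontal rows, from left to right $D'_{2d},\dots,D'_1,B'_1,\dots,B'_{2b}$ in the upper row and $D''_{2d},\dots,D''_1,B''_1,\dots,B''_{2b}$ in the lower row, the $D$'s to the left and the $B$'s to the right of the imaginary axis. Consider the straight segments $a_i=B'_iB'_{i+1}$, $c_i=B''_iB''_{i+1}$ ($1\le i\le 2b-1$), $b_j=D'_jD'_{j+1}$, $d_j=D''_jD''_{j+1}$ ($1\le j\le 2d-1$), $p_i=B'_iB''_i$ ($1\le i\le 2b$), $q_j=D'_jD''_j$ ($1\le j\le 2d$), $u'=D'_1B'_1$, $u''=D''_1B''_1$, $u=B'_1D''_1$, and let $s$ be the image of $u$ under the positive half-twists on $u'$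 and $u''$ (an arc from $D'_1$ to $B''_1$). For an arc $\tau$ joining two marked points let $\sigma_\tau\in\mathrm{Br}_n$ be the positive half-twist on $\tau$; the full twist on $\tau$ is $\sigma_\tau^2$. Explicitly: number the marked points $1,\dots,n$ in the order $D''_1,\dots,D''_{2d},D'_{2d},\dots,D'_1,B'_1,\dots,B'_{2b},B''_{2b},\dots,B''_1$; then for $k<l$ the half-twist on the segment joining the points number $k$ and $l$ is $(\sigma_{l-1}\cdots\sigma_{k+1})\,\sigma_k\,(\sigma_{l-1}\cdots\sigma_{k+1})^{-1}$, and $\sigma_s=(\sigma_{u'}\sigma_{u''})\,\sigma_u\,(\sigma_{u'}\sigma_{u''})^{-1}$. Let $H\subset\mathrm{Br}_n$ be the (braid monodromy) group generated by $$\sigma_{a_i},\ \sigma_{c_i}\ (1\le i\le 2b-1),\quad \sigma_{b_j},\ \sigma_{d_j}\ (1\le j\le 2d-1),\quad \sigma_{p_{2b}}^2,\ \sigma_{q_{2d}}^2,\ \sigma_s,\ \sigma_{u'}^3,\ \sigma_{u''}^3 .$$ Let $\theta$ be the homomorphism from the fundamental group of the complement of the marked points (based at the origin, between the two rows) to the symmetric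 group $\mathfrak S_4$ that sends a simple loop around $D'_j$, $D''_j$, $B'_i$, $B''_i$ not crossing the imaginary axis to $(12)$, $(34)$, $(13)$, $(24)$ respectively. A full twist $\sigma_\tau^2$ on an arc $\tau$ joining two marked points is called admissible if the values of $\theta$ on the loops around the two end points of $\tau$, taken along $\tau$ from a base point on $\tau$, are disjoint transpositions. Let $\hat H\subset\mathrm{Br}_n$ be the (stabilized braid monodromy) group generated by $H$ and all admissible full twists. Then for all $1\le i\le 2b$ and $1\le j\le 2d$: 1. there is no $\hat h\in\hat H$ with $\hat h\,\sigma_{p_i}=\sigma_{q_j}\,\hat h$; 2. there is no $h\in H$ with $h\,\sigma_{p_i}^2\,h^{-1}=\sigma_{q_j}^2$, and there is not even such an $h$ in $\hat H$. That is, no half-twist (respectively full twist) on an arc $p_i$ is conjugate under the stabilized braid monodromy group, hence under the braid monodromy group, to the half-twist (respectively full twist) on an arc $q_j$. -/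

import Mathlib

namespace BidoubleBraid

/-! ### The braid group of the sphere -/

/-- The defining relators of the braid group of the sphere on `n` strands, in the generators
`σ_1, …, σ_{n-1}`; the element `k : Fin (n - 1)` stands for the index `k + 1`. -/
def sphereBraidRels (n : ℕ) : Set (FreeGroup (Fin (n - 1))) :=
  {r | ∃ i j : Fin (n - 1), (i : ℕ) + 1 < j ∧
      r = (FreeGroup.of i * FreeGroup.of j) * (FreeGroup.of j * FreeGroup.of i)⁻¹} ∪
  {r | ∃ i j : Fin (n - 1), (i : ℕ) + 1 = j ∧
      r = (FreeGroup.of i * FreeGroup.of j * FreeGroup.of i) *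
        (FreeGroup.of j * FreeGroup.of i * FreeGroup.of j)⁻¹} ∪
  {(List.ofFn fun i : Fin (n - 1) => FreeGroup.of i).prod *
      (List.ofFn fun i : Fin (n - 1) => FreeGroup.of i).reverse.prod}

/-- The braid group `Br_n` of the sphere: generators `σ_1, …, σ_{n-1}`, the braid relations, and
`σ_1 ⋯ σ_{n-1} σ_{n-1} ⋯ σ_1 = 1`. -/
abbrev SphereBraid (n : ℕ) : Type := PresentedGroup (sphereBraidRels n)

/-- The generator `σ_k` of `Br_n`, for `1 ≤ k ≤ n - 1` (the value `1` at other `k` is never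
used). -/
def sigma (n k : ℕ) : SphereBraid n :=
  if h : 1 ≤ k ∧ k ≤ n - 1 then PresentedGroup.of ⟨k - 1, by omega⟩ else 1

/-! ### Half-twists on arcs

Put the `n` marked points, numbered `1, …, n`, on the real line from left to right (or, bending
the line to the boundary of a convex polygon, at the vertices of a polygon in clockwise order, its
interior being the region below the line). The generator `σ_k` is the counterclockwise half-twist
on the segment from point `k` to point `k + 1`; a product `g * h` means `h` first, then `g`.
Hence, if `σ_τ` denotes the half-twist on an arc `τ`, then `g * σ_τ * g⁻¹` is the half-twist on the
arc `g(τ)`, and every half-twist on an arc is of the form `g * σ_k * g⁻¹`. -/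

/-- The half-twist on the arc from point `i` to point `j`, for `1 ≤ i < j ≤ n`, that runs below the
points strictly between them, i.e. on the chord from `i` to `j` of the polygon:
`(σ_{j-1} ⋯ σ_{i+1}) σ_i (σ_{j-1} ⋯ σ_{i+1})⁻¹`. -/
def chordTwist (n i j : ℕ) : SphereBraid n :=
  ((List.Ico (i + 1) j).reverse.map (sigma n)).prod * sigma n i *
    (((List.Ico (i + 1) j).reverse.map (sigma n)).prod)⁻¹

/-! ### The marked points and the arcs

There are `4 (b + d)` marked points, on two horizontal rows, from left to right
`D'_{2d}, …, D'_1, B'_1, …, B'_{2b}` (upper row) and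
`D''_{2d}, …, D''_1, B''_1, …, B''_{2b}` (lower row).
They are the vertices of a polygon with interior the region between the two rows, and are numbered
clockwise, starting from `D''_1`:
`D''_1, …, D''_{2d}, D'_{2d}, …, D'_1, B'_1, …, B'_{2b}, B''_{2b}, …, B''_1`. -/

/-- The number of marked points. -/
abbrev numPts (b d : ℕ) : ℕ := 4 * (b + d)

/-- The number of the point `D''_j`, `1 ≤ j ≤ 2d`. -/
def ptD'' (j : ℕ) : ℕ := j

/-- The number of the point `D'_j`, `1 ≤ j ≤ 2d`. -/
def ptD' (d j : ℕ) : ℕ := 4 * d + 1 - j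

/-- The number of the point `B'_i`, `1 ≤ i ≤ 2b`. -/
def ptB' (d i : ℕ) : ℕ := 4 * d + i

/-- The number of the point `B''_i`, `1 ≤ i ≤ 2b`. -/
def ptB'' (b d i : ℕ) : ℕ := numPts b d + 1 - i

/-- Half-twist on the segment `a_i` from `B'_i` to `B'_{i+1}`, `1 ≤ i ≤ 2b - 1`. -/
def twistA (b d i : ℕ) : SphereBraid (numPts b d) :=
  chordTwist (numPts b d) (ptB' d i) (ptB' d (i + 1))

/-- Half-twist on the segment `c_i` from `B''_i` to `B''_{i+1}`, `1 ≤ i ≤ 2b - 1`. -/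
def twistC (b d i : ℕ) : SphereBraid (numPts b d) :=
  chordTwist (numPts b d) (ptB'' b d (i + 1)) (ptB'' b d i)

/-- Half-twist on the segment `b_j` from `D'_j` to `D'_{j+1}`, `1 ≤ j ≤ 2d - 1`. -/
def twistB (b d j : ℕ) : SphereBraid (numPts b d) :=
  chordTwist (numPts b d) (ptD' d (j + 1)) (ptD' d j)

/-- Half-twist on the segment `d_j` from `D''_j` to `D''_{j+1}`, `1 ≤ j ≤ 2d - 1`. -/
def twistD (b d j : ℕ) : SphereBraid (numPts b d) :=
  chordTwist (numPts b d) (ptD'' j) (ptD'' (j + 1))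

/-- Half-twist on the vertical segment `p_i` from `B'_i` to `B''_i`, `1 ≤ i ≤ 2b`. -/
def twistP (b d i : ℕ) : SphereBraid (numPts b d) :=
  chordTwist (numPts b d) (ptB' d i) (ptB'' b d i)

/-- Half-twist on the vertical segment `q_j` from `D'_j` to `D''_j`, `1 ≤ j ≤ 2d`. -/
def twistQ (b d j : ℕ) : SphereBraid (numPts b d) :=
  chordTwist (numPts b d) (ptD'' j) (ptD' d j)

/-- Half-twist on the segment `u'` from `D'_1` to `B'_1`. -/
def twistU' (b d : ℕ) : SphereBraid (numPts b d) :=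
  chordTwist (numPts b d) (ptD' d 1) (ptB' d 1)

/-- Half-twist on the segment `u''` from `D''_1` to `B''_1`. -/
def twistU'' (b d : ℕ) : SphereBraid (numPts b d) :=
  chordTwist (numPts b d) (ptD'' 1) (ptB'' b d 1)

/-- Half-twist on the diagonal segment `u` from `B'_1` to `D''_1`. -/
def twistU (b d : ℕ) : SphereBraid (numPts b d) :=
  chordTwist (numPts b d) (ptD'' 1) (ptB' d 1)

/-- Half-twist on the arc `s`, the image of `u` under the half-twists on `u'` and `u''`. From
`D'_1` the arc `s` passes over `B'_1`, crosses `a_1`, then `p_1`, goes diagonally through the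
middle of the polygon, crosses `q_1`, then `d_1`, and passes under `D''_1` to `B''_1`. -/
def twistS (b d : ℕ) : SphereBraid (numPts b d) :=
  (twistU' b d * twistU'' b d) * twistU b d * (twistU' b d * twistU'' b d)⁻¹

/-! ### The braid monodromy group -/

/-- The generators of the braid monodromy group: the half-twists on `a_i, c_i` (`1 ≤ i ≤ 2b - 1`),
on `b_j, d_j` (`1 ≤ j ≤ 2d - 1`) and on `s`, the full twists on `p_{2b}` and `q_{2d}`, and the
cubes of the half-twists on `u'` and `u''`. -/
def monodromyGenerators (b d : ℕ) : Set (SphereBraid (numPts b d)) :=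
  {x | ∃ i, 1 ≤ i ∧ i ≤ 2 * b - 1 ∧ (x = twistA b d i ∨ x = twistC b d i)} ∪
  {x | ∃ j, 1 ≤ j ∧ j ≤ 2 * d - 1 ∧ (x = twistB b d j ∨ x = twistD b d j)} ∪
  {twistP b d (2 * b) ^ 2, twistQ b d (2 * d) ^ 2, twistS b d,
    twistU' b d ^ 3, twistU'' b d ^ 3}

/-- The braid monodromy group `H`. -/
def monodromyGroup (b d : ℕ) : Subgroup (SphereBraid (numPts b d)) :=
  Subgroup.closure (monodromyGenerators b d)

/-! ### The covering monodromy, admissible full twists, the stabilized group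

Take a base point inside the polygon and for each marked point the loop `γ_k` that goes straight to
the point numbered `k`, once around it counterclockwise, and back. A homomorphism from the
fundamental group of the complement of the marked points to a group `K` is recorded by its values
on `γ_1, …, γ_n`; below, position `k : Fin n` belongs to the point numbered `k + 1`. -/

/-- The left end of the segment `σ_{i+1}` twists, as a position. -/
def leftPos {n : ℕ} (i : Fin (n - 1)) : Fin n := ⟨i, by omega⟩

/-- The right end of the segment `σ_{i+1}` twists, as a position. -/
def rightPos {n : ℕ} (i : Fin (n - 1)) : Fin n := ⟨i + 1, by omega⟩

/-- Precomposition with a generating half-twist, which carries the loops `γ_l, γ_r` at the two ends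
of its segment to `γ_r` and `γ_r⁻¹ γ_l γ_r`. -/
def hurwitzMove {n : ℕ} {K : Type*} [Group K] (i : Fin (n - 1)) : Equiv.Perm (Fin n → K) where
  toFun t := fun k =>
    if k = leftPos i then t (rightPos i)
    else if k = rightPos i then (t (rightPos i))⁻¹ * t (leftPos i) * t (rightPos i)
    else t k
  invFun t := fun k =>
    if k = leftPos i then t (leftPos i) * t (rightPos i) * (t (leftPos i))⁻¹
    else if k = rightPos i then t (leftPos i)
    else t k
  left_inv t := by
    have h : (rightPos i : Fin n) ≠ leftPos i := by simp [leftPos, rightPos, Fin.ext_iff]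
    funext k
    by_cases h1 : k = leftPos i
    · subst h1; simp [h]; group
    · by_cases h2 : k = rightPos i
      · subst h2; simp [h]
      · simp [h1, h2]
  right_inv t := by
    have h : (rightPos i : Fin n) ≠ leftPos i := by simp [leftPos, rightPos, Fin.ext_iff]
    funext k
    by_cases h1 : k = leftPos i
    · subst h1; simp [h]
    · by_cases h2 : k = rightPos i
      · subst h2; simp [h]; group
      · simp [h1, h2]

/-- The right action of braid words on tuples by precomposition: `pullback t (v * w)` is
`pullback (pullback t v) w`. The entry of `pullback t w` at position `k` is the value of the
homomorphism `t` on the image of the loop `γ_{k+1}` under the braid `w`. -/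
def pullback {n : ℕ} {K : Type*} [Group K] (t : Fin n → K) (w : FreeGroup (Fin (n - 1))) :
    Fin n → K :=
  (FreeGroup.lift (fun i => MulOpposite.op (hurwitzMove (K := K) i)) w).unop t

/-- The covering monodromy `θ` of the fourfold cover: `(1 2)` at the points `D'_j`, `(3 4)` at
`D''_j`, `(1 3)` at `B'_i`, `(2 4)` at `B''_i` (the four sheets are `0, 1, 2, 3` here). -/
def coverMonodromy (b d : ℕ) : Fin (numPts b d) → Equiv.Perm (Fin 4) := fun k =>
  if (k : ℕ) < 2 * d then Equiv.swap 2 3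
  else if (k : ℕ) < 4 * d then Equiv.swap 0 1
  else if (k : ℕ) < 4 * d + 2 * b then Equiv.swap 0 2
  else Equiv.swap 1 3

/-- The admissible full twists: the full twists on those arcs for which the covering monodromies
around the two end points, with respect to a base point on the arc, are disjoint transpositions.
The arc is the image, under the braid given by the word `w`, of the segment that `σ_{i+1}`
twists. -/
def admissibleFullTwists (b d : ℕ) : Set (SphereBraid (numPts b d)) :=
  {x | ∃ (w : FreeGroup (Fin (numPts b d - 1))) (i : Fin (numPts b d - 1)),
    Equiv.Perm.Disjoint (pullback (coverMonodromy b d) w (leftPos i))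
      (pullback (coverMonodromy b d) w (rightPos i)) ∧
    x = PresentedGroup.mk _ w * PresentedGroup.of i ^ 2 * (PresentedGroup.mk _ w)⁻¹}

/-- The stabilized braid monodromy group `Ĥ`, generated by `H` and all admissible full twists. -/
def stabilizedMonodromyGroup (b d : ℕ) : Subgroup (SphereBraid (numPts b d)) :=
  Subgroup.closure (monodromyGenerators b d ∪ admissibleFullTwists b d)

end BidoubleBraid

/-!
Represent the transpositions of `𝔖₄` as the reflections, taken modulo `2`, of the affine Weyl
group of type `A₂`: disjoint transpositions are then the reflections in parallel lines. Braid
words act on sequences of such reflections by Hurwitz moves, and relators of the sphere braid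
group act by inner automorphisms on the sequences with trivial product. The covering monodromy
becomes a sequence with direction `0` at the `D`'s and `1` at the `B`'s, and a word that preserves
these directions acts additively on the offsets of the lines.

All generators of the stabilized braid monodromy group preserve a `ℤ/4`-valued quadratic form of
the offsets modulo `2`: the half-twists act as transvections in vectors on which the form is `2`,
and the full twists and the cubes act trivially. With integral offsets, however, the full twists
on `q_j` and `p_i` translate a sequence by even multiples of vectors `v_Q` and `v_P`. Halving
these translations, a conjugation by the word `w` would give `w v_Q ≡ l v_P + const` modulo `2`,
with one constant on the `D`'s and one on the `B`'s. The form is `2` on the left and `0` on the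
right.
-/

namespace BidoubleBraid

open scoped Quandles

section WordAction

variable {ι X Y : Type*}

/-- The right action of words in the letters `ι` on `X` through given permutations: the leftmost
letter of a word acts first, as in `pullback`. -/
def wordAction (a : ι → Equiv.Perm X) (w : FreeGroup ι) : Equiv.Perm X :=
  (FreeGroup.lift (fun i => MulOpposite.op (a i)) w).unop

@[simp]
theorem wordAction_one (a : ι → Equiv.Perm X) : wordAction a 1 = 1 := by
  simp [wordAction]

theorem wordAction_mul (a : ι → Equiv.Perm X) (v w : FreeGroup ι) :
    wordAction a (v * w) = wordAction a w * wordAction a v := by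
  simp [wordAction]

@[simp]
theorem wordAction_of (a : ι → Equiv.Perm X) (i : ι) : wordAction a (FreeGroup.of i) = a i := by
  simp [wordAction]

theorem wordAction_inv (a : ι → Equiv.Perm X) (w : FreeGroup ι) :
    wordAction a w⁻¹ = (wordAction a w)⁻¹ := by
  simp [wordAction]

theorem wordAction_semiconj {F : X → Y} {a : ι → Equiv.Perm X} {b : ι → Equiv.Perm Y}
    (h : ∀ i, Function.Semiconj F (a i) (b i)) (w : FreeGroup ι) :
    Function.Semiconj F (wordAction a w) (wordAction b w) := by
  induction w using FreeGroup.induction_on with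
  | C1 => simp [Function.Semiconj]
  | of i => simpa using h i
  | inv_of i _ =>
    simp only [wordAction_inv, wordAction_of]
    exact (h i).inverses_right (a i).right_inv (b i).left_inv
  | mul v w hv hw =>
    simp only [wordAction_mul, Equiv.Perm.coe_mul]
    exact hw.comp_right hv

theorem wordAction_invariant {F : X → Y} {a : ι → Equiv.Perm X} (h : ∀ i x, F (a i x) = F x)
    (w : FreeGroup ι) (x : X) : F (wordAction a w x) = F x := by
  have trivial_action : FreeGroup.lift (fun _ : ι => (1 : (Equiv.Perm Y)ᵐᵒᵖ)) = 1 :=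
    FreeGroup.ext_hom _ _ fun i => by simp
  simpa [wordAction, trivial_action] using wordAction_semiconj (F := F) (b := fun _ => 1) h w x

end WordAction

section Rack

variable {R S : Type*} [Rack R] [Rack S] {n : ℕ}

theorem map_invAct (f : R →◃ S) (x y : R) : f (x ◃⁻¹ y) = f x ◃⁻¹ f y := by
  rw [← Rack.left_cancel (f x), ← f.map_act, Rack.act_invAct_eq, Rack.act_invAct_eq]

/-- The Hurwitz move at the positions `i` and `i + 1` of a sequence in a rack. Sequences are indexed
by `ℕ`, and a braid word on `n` strands only sees the first `n` entries. -/
def rackMove (i : ℕ) : Equiv.Perm (ℕ → R) where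
  toFun t k := if k = i then t (i + 1) else if k = i + 1 then t (i + 1) ◃⁻¹ t i else t k
  invFun t k := if k = i then t i ◃ t (i + 1) else if k = i + 1 then t i else t k
  left_inv t := by ext k; grind [Rack.act_invAct_eq]
  right_inv t := by ext k; grind [Rack.invAct_act_eq]

theorem rackMove_apply (i : ℕ) (t : ℕ → R) (k : ℕ) : rackMove i t k =
    if k = i then t (i + 1) else if k = i + 1 then t (i + 1) ◃⁻¹ t i else t k := rfl

/-- The right action of braid words on sequences in a rack, the analogue of `pullback`. -/
def rackPullback (t : ℕ → R) (w : FreeGroup (Fin (n - 1))) : ℕ → R :=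
  wordAction (fun i : Fin (n - 1) => rackMove i) w t

@[simp]
theorem rackPullback_one (t : ℕ → R) : rackPullback t (1 : FreeGroup (Fin (n - 1))) = t := by
  simp [rackPullback]

theorem rackPullback_mul (t : ℕ → R) (v w : FreeGroup (Fin (n - 1))) :
    rackPullback t (v * w) = rackPullback (rackPullback t v) w := by
  simp [rackPullback, wordAction_mul]

@[simp]
theorem rackPullback_of (t : ℕ → R) (i : Fin (n - 1)) :
    rackPullback t (FreeGroup.of i) = rackMove i t := by
  simp [rackPullback]

@[simp]
theorem rackPullback_mul_inv (t : ℕ → R) (w : FreeGroup (Fin (n - 1))) :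
    rackPullback (rackPullback t w) w⁻¹ = t := by
  rw [← rackPullback_mul, mul_inv_cancel, rackPullback_one]

@[simp]
theorem rackPullback_inv_mul (t : ℕ → R) (w : FreeGroup (Fin (n - 1))) :
    rackPullback (rackPullback t w⁻¹) w = t := by
  rw [← rackPullback_mul, inv_mul_cancel, rackPullback_one]

theorem rackPullback_comp (f : R →◃ S) (t : ℕ → R) (w : FreeGroup (Fin (n - 1))) :
    rackPullback (f ∘ t) w = f ∘ rackPullback t w := by
  refine (wordAction_semiconj (F := fun t : ℕ → R => f ∘ t) (fun i t => ?_) w t).symm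
  ext k
  simp only [Function.comp_apply, rackMove_apply, apply_ite f, map_invAct]

theorem rackPullback_congr {t t' : ℕ → R} (h : ∀ k < n, t k = t' k)
    (w : FreeGroup (Fin (n - 1))) {k : ℕ} (hk : k < n) :
    rackPullback t w k = rackPullback t' w k := by
  let truncate (s : ℕ → R) : ℕ → R := fun k => if k < n then s k else t k
  have semiconj (s : ℕ → R) :
      truncate (rackPullback s w) = rackPullback (truncate s) w := by
    refine wordAction_semiconj (fun i s => ?_) w s
    ext k
    have := i.2
    simp only [truncate, rackMove_apply]
    grind
  have truncate_eq : truncate t = truncate t' := by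
    ext k
    simp only [truncate]
    grind
  have key := congrFun ((semiconj t).trans (truncate_eq ▸ (semiconj t').symm)) k
  simpa only [truncate, if_pos hk] using key

theorem pullback_conj {K : Type*} [Group K] (f : R →◃ Quandle.Conj K) (t : ℕ → R)
    (w : FreeGroup (Fin (n - 1))) (k : Fin n) :
    pullback (fun k : Fin n => (f (t k) : K)) w k = f (rackPullback t w k) := by
  refine congrFun (wordAction_semiconj (F := fun (t : ℕ → R) (k : Fin n) => (f (t k) : K))
    (fun i t => ?_) w t).symm k
  ext k
  simp only [rackMove_apply, hurwitzMove, Equiv.coe_fn_mk, leftPos, rightPos, Fin.ext_iff]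
  split_ifs
  · rfl
  · rw [map_invAct]
    rfl
  · rfl

theorem rackMove_comm {i j : ℕ} (h : i + 1 < j) (t : ℕ → R) :
    rackMove i (rackMove j t) = rackMove j (rackMove i t) := by
  ext k
  simp only [rackMove_apply]
  grind

theorem rackMove_braid (i : ℕ) (t : ℕ → R) :
    rackMove i (rackMove (i + 1) (rackMove i t)) =
      rackMove (i + 1) (rackMove i (rackMove (i + 1) t)) := by
  ext k
  simp only [rackMove_apply]
  grind [Rack.self_distrib_inv]

theorem rackMove_sq {i : ℕ} {t : ℕ → R} (h : t i ◃ t (i + 1) = t (i + 1))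
    (h' : t (i + 1) ◃ t i = t i) : rackMove i (rackMove i t) = t := by
  have inv : t (i + 1) ◃⁻¹ t i = t i := by rw [← Rack.left_cancel, Rack.act_invAct_eq, h']
  have inv' : t i ◃⁻¹ t (i + 1) = t (i + 1) := by rw [← Rack.left_cancel, Rack.act_invAct_eq, h]
  ext k
  simp only [rackMove_apply]
  grind

/-- The product, in the group of permutations of the rack, of the entries of a sequence at the
positions `a, …, b - 1`. -/
def rackProd (t : ℕ → R) (a b : ℕ) : Equiv.Perm R :=
  ((List.Ico a b).map fun k => Rack.act' (t k)).prod

theorem rackProd_self (t : ℕ → R) (a : ℕ) : rackProd t a a = 1 := by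
  simp [rackProd]

theorem rackProd_eq_mul (t : ℕ → R) {a b : ℕ} (h : a < b) :
    rackProd t a b = Rack.act' (t a) * rackProd t (a + 1) b := by
  simp [rackProd, List.Ico.eq_cons h]

theorem rackProd_mul_rackProd (t : ℕ → R) {a b c : ℕ} (hab : a ≤ b) (hbc : b ≤ c) :
    rackProd t a b * rackProd t b c = rackProd t a c := by
  simp [rackProd, ← List.Ico.append_consecutive hab hbc]

theorem rackProd_congr {t t' : ℕ → R} {a b : ℕ} (h : ∀ k, a ≤ k → k < b → t k = t' k) :
    rackProd t a b = rackProd t' a b := by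
  refine congrArg List.prod (List.map_congr_left fun k hk => ?_)
  rw [List.Ico.mem] at hk
  rw [h k hk.1 hk.2]

theorem act'_invAct (x y : R) :
    Rack.act' (x ◃⁻¹ y) = (Rack.act' x)⁻¹ * Rack.act' y * Rack.act' x := by
  have h := Rack.ad_conj x (x ◃⁻¹ y)
  rw [Rack.act_invAct_eq] at h
  rw [h]
  group

theorem rackProd_rackMove (t : ℕ → R) {i m : ℕ} (h : i + 2 ≤ m) :
    rackProd (rackMove i t) 0 m = rackProd t 0 m := by
  have outer {a b : ℕ} (hab : b ≤ i ∨ i + 2 ≤ a) :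
      rackProd (rackMove i t) a b = rackProd t a b :=
    rackProd_congr fun k _ _ => by rw [rackMove_apply, if_neg (by lia), if_neg (by lia)]
  have inner : rackProd (rackMove i t) i (i + 2) = rackProd t i (i + 2) := by
    simp [rackProd_eq_mul, rackProd_self, rackMove_apply, act'_invAct, mul_assoc]
  rw [← rackProd_mul_rackProd _ (Nat.zero_le i) (by lia),
    ← rackProd_mul_rackProd _ (Nat.le_add_right i 2) h, outer (.inl le_rfl), inner,
    outer (.inr le_rfl), rackProd_mul_rackProd _ (Nat.le_add_right i 2) h,
    rackProd_mul_rackProd _ (Nat.zero_le i) (by lia)]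

theorem rackProd_rackPullback (t : ℕ → R) (w : FreeGroup (Fin (n - 1))) :
    rackProd (rackPullback t w) 0 n = rackProd t 0 n :=
  wordAction_invariant (F := fun t : ℕ → R => rackProd t 0 n)
    (fun i t => rackProd_rackMove t (by have := i.2; lia)) w t

end Rack

section InnerAutomorphisms

variable {R : Type*} [Rack R] {n : ℕ}

variable (R) in
/-- The group of inner automorphisms of a rack, generated by the actions of its elements. -/
def innerAut : Subgroup (Equiv.Perm R) :=
  Subgroup.closure (Set.range Rack.act')

theorem act'_mem_innerAut (x : R) : Rack.act' x ∈ innerAut R :=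
  Subgroup.subset_closure ⟨x, rfl⟩

theorem innerAut_map_act {g : Equiv.Perm R} (hg : g ∈ innerAut R) (x y : R) :
    g (x ◃ y) = g x ◃ g y := by
  induction hg using Subgroup.closure_induction generalizing x y with
  | mem _ hx =>
    obtain ⟨z, rfl⟩ := hx
    exact Shelf.self_distrib
  | one => rfl
  | mul g g' _ _ hg hg' => simp [hg, hg']
  | inv g _ hg => exact g.injective (by simp [hg])

/-- Two sequences whose first `n` entries differ by a common inner automorphism. -/
def InnerEquiv (n : ℕ) (t t' : ℕ → R) : Prop :=
  ∃ g ∈ innerAut R, ∀ k < n, t' k = g (t k)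

theorem InnerEquiv.refl (t : ℕ → R) : InnerEquiv n t t :=
  ⟨1, one_mem _, fun _ _ => rfl⟩

theorem InnerEquiv.symm {t t' : ℕ → R} (h : InnerEquiv n t t') : InnerEquiv n t' t := by
  obtain ⟨g, hg, h⟩ := h
  exact ⟨g⁻¹, inv_mem hg, fun k hk => by simp [h k hk]⟩

theorem InnerEquiv.trans {t t' t'' : ℕ → R} (h : InnerEquiv n t t') (h' : InnerEquiv n t' t'') :
    InnerEquiv n t t'' := by
  obtain ⟨g, hg, h⟩ := h
  obtain ⟨g', hg', h'⟩ := h'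
  exact ⟨g' * g, mul_mem hg' hg, fun k hk => by simp [h' k hk, h k hk]⟩

theorem InnerEquiv.rackPullback {t t' : ℕ → R} (h : InnerEquiv n t t')
    (w : FreeGroup (Fin (n - 1))) : InnerEquiv n (rackPullback t w) (rackPullback t' w) := by
  obtain ⟨g, hg, h⟩ := h
  refine ⟨g, hg, fun k hk => ?_⟩
  rw [rackPullback_congr (t' := g ∘ t) h w hk]
  exact congrFun (rackPullback_comp ⟨g, innerAut_map_act hg _ _⟩ t w) k

variable (R n) in
/-- The braid words that move no sequence of trivial product out of its class under inner
automorphisms. -/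
def innerWords : Subgroup (FreeGroup (Fin (n - 1))) where
  carrier := {w | ∀ t : ℕ → R, rackProd t 0 n = 1 → InnerEquiv n t (rackPullback t w)}
  one_mem' t _ := by simpa using InnerEquiv.refl t
  mul_mem' {v w} hv hw t ht := by
    rw [rackPullback_mul]
    exact (hv t ht).trans (hw _ (by rw [rackProd_rackPullback, ht]))
  inv_mem' {w} hw t ht := by
    simpa using (hw (rackPullback t w⁻¹) (by rw [rackProd_rackPullback, ht])).symm

theorem mem_innerWords {w : FreeGroup (Fin (n - 1))} : w ∈ innerWords R n ↔
    ∀ t : ℕ → R, rackProd t 0 n = 1 → InnerEquiv n t (rackPullback t w) := Iff.rfl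

instance : (innerWords R n).Normal where
  conj_mem w hw v := by
    rw [mem_innerWords] at hw ⊢
    intro t ht
    have h := (hw (rackPullback t v) (by rw [rackProd_rackPullback, ht])).rackPullback v⁻¹
    rwa [rackPullback_mul_inv, ← rackPullback_mul, ← rackPullback_mul, ← mul_assoc] at h

theorem mul_inv_mem_innerWords {v w : FreeGroup (Fin (n - 1))}
    (h : ∀ t : ℕ → R, rackPullback t v = rackPullback t w) : v * w⁻¹ ∈ innerWords R n :=
  fun t _ => by simpa [rackPullback_mul, h] using InnerEquiv.refl t

end InnerAutomorphisms

section SphereRelators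

variable {R : Type*} [Rack R] {n : ℕ}

/-- The word of the generator `sigma n k`. -/
def sigmaWord (n k : ℕ) : FreeGroup (Fin (n - 1)) :=
  if h : 1 ≤ k ∧ k ≤ n - 1 then FreeGroup.of ⟨k - 1, by omega⟩ else 1

theorem mk_sigmaWord (n k : ℕ) :
    PresentedGroup.mk (sphereBraidRels n) (sigmaWord n k) = sigma n k := by
  unfold sigmaWord sigma
  split_ifs
  · rfl
  · simp

theorem rackPullback_sigmaWord (t : ℕ → R) {k : ℕ} (hk : k + 1 < n) :
    rackPullback t (sigmaWord n (k + 1)) = rackMove k t := by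
  rw [sigmaWord, dif_pos (by lia), rackPullback_of]
  rfl

theorem ofFn_of_eq_map_sigmaWord (n : ℕ) :
    (List.ofFn fun i : Fin (n - 1) => FreeGroup.of i) = (List.Ico 1 n).map (sigmaWord n) := by
  refine List.ext_getElem (by simp) fun k hk _ => ?_
  rw [List.length_ofFn] at hk
  simp [List.Ico, sigmaWord, show 1 + k ≤ n - 1 by lia]

/-- The braid that pulls the strand at position `a` around all strands to its right. -/
def loopWord (n a : ℕ) : FreeGroup (Fin (n - 1)) :=
  ((List.Ico (a + 1) n).map (sigmaWord n)).prod *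
    ((List.Ico (a + 1) n).map (sigmaWord n)).reverse.prod

theorem loopWord_eq (n : ℕ) {a : ℕ} (h : a + 1 < n) :
    loopWord n a = sigmaWord n (a + 1) * loopWord n (a + 1) * sigmaWord n (a + 1) := by
  simp [loopWord, List.Ico.eq_cons h, mul_assoc]

theorem rackPullback_loopWord (t : ℕ → R) {a k : ℕ} (ha : a < n) (hk : k < n) :
    rackPullback t (loopWord n a) k =
      if k < a then t k
      else if k = a then (rackProd t (a + 1) n)⁻¹ (t a)
      else (rackProd t (a + 1) n)⁻¹ (t a) ◃⁻¹ t k := by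
  induction hm : n - a - 1 generalizing a t k with
  | zero =>
    have h_last : n = a + 1 := by lia
    subst h_last
    have one : loopWord (a + 1) a = 1 := by simp [loopWord]
    rw [one, rackPullback_one, rackProd_self, inv_one, Equiv.Perm.one_apply]
    grind
  | succ m ih =>
    have unchanged : rackProd (rackMove a t) (a + 2) n = rackProd t (a + 2) n :=
      rackProd_congr fun k _ _ => by rw [rackMove_apply, if_neg (by lia), if_neg (by lia)]
    have first (x : R) :
        (rackProd t (a + 1) n)⁻¹ x = (rackProd t (a + 2) n)⁻¹ (t (a + 1) ◃⁻¹ x) := by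
      rw [rackProd_eq_mul t (by lia), mul_inv_rev, Equiv.Perm.mul_apply, Rack.invAct_apply]
    have inner {k : ℕ} (hk : k < n) :=
      ih (rackMove a t) (a := a + 1) (by lia) hk (by lia)
    rw [unchanged] at inner
    rw [loopWord_eq n (by lia), rackPullback_mul, rackPullback_mul,
      rackPullback_sigmaWord _ (by lia), rackPullback_sigmaWord _ (by lia), first]
    simp only [rackMove_apply] at inner ⊢
    grind

end SphereRelators

section SphereBraidWords

variable {Q : Type*} [Quandle Q] {n : ℕ}

theorem loopWord_zero_mem_innerWords : loopWord n 0 ∈ innerWords Q n := by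
  intro t ht
  refine ⟨(Rack.act' (t 0))⁻¹, inv_mem (act'_mem_innerAut _), fun k hk => ?_⟩
  have tail : (rackProd t 1 n)⁻¹ = Rack.act' (t 0) := by
    rw [rackProd_eq_mul t (by lia)] at ht
    exact inv_eq_of_mul_eq_one_left ht
  rw [rackPullback_loopWord t (by lia) hk, if_neg (by lia), tail, Rack.act'_apply, Quandle.fix,
    Rack.invAct_apply]
  split_ifs with h
  · rw [h, Quandle.fix_inv]
  · rfl

theorem sphereBraidRels_subset_innerWords : sphereBraidRels n ⊆ innerWords Q n := by
  rintro _ ((⟨i, j, hij, rfl⟩ | ⟨i, j, hij, rfl⟩) | rfl)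
  · exact mul_inv_mem_innerWords fun t => by
      simpa only [rackPullback_mul, rackPullback_of] using (rackMove_comm hij t).symm
  · exact mul_inv_mem_innerWords fun t => by
      simpa only [rackPullback_mul, rackPullback_of, ← hij] using rackMove_braid i t
  · rw [ofFn_of_eq_map_sigmaWord]
    exact loopWord_zero_mem_innerWords

theorem innerEquiv_of_mk_eq {v w : FreeGroup (Fin (n - 1))}
    (h : PresentedGroup.mk (sphereBraidRels n) v = PresentedGroup.mk (sphereBraidRels n) w)
    {t : ℕ → Q} (ht : rackProd t 0 n = 1) :
    InnerEquiv n (rackPullback t v) (rackPullback t w) := by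
  have mem : v⁻¹ * w ∈ innerWords Q n :=
    Subgroup.normalClosure_le_normal sphereBraidRels_subset_innerWords
      (QuotientGroup.eq.mp h)
  simpa [← rackPullback_mul] using mem (rackPullback t v) (by rw [rackProd_rackPullback, ht])

end SphereBraidWords

section Chords

variable {R : Type*} [Rack R] {n : ℕ}

/-- The word of the half-twist `chordTwist n i j`. -/
def chordWord (n i j : ℕ) : FreeGroup (Fin (n - 1)) :=
  ((List.Ico (i + 1) j).reverse.map (sigmaWord n)).prod * sigmaWord n i *
    (((List.Ico (i + 1) j).reverse.map (sigmaWord n)).prod)⁻¹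

theorem mk_chordWord (n i j : ℕ) :
    PresentedGroup.mk (sphereBraidRels n) (chordWord n i j) = chordTwist n i j := by
  have mk_comp : PresentedGroup.mk (sphereBraidRels n) ∘ sigmaWord n = sigma n :=
    funext (mk_sigmaWord n)
  simp only [chordWord, chordTwist, map_mul, map_inv, map_list_prod, List.map_map, mk_comp,
    mk_sigmaWord]

theorem chordWord_self_succ (n i : ℕ) : chordWord n i (i + 1) = sigmaWord n i := by
  simp [chordWord]

theorem chordWord_succ (n : ℕ) {i j : ℕ} (h : i < j) :
    chordWord n i (j + 1) = sigmaWord n j * chordWord n i j * (sigmaWord n j)⁻¹ := by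
  simp [chordWord, List.Ico.succ_top h, mul_assoc]

/-- The effect on sequences of the half-twist on the chord between the positions `i` and `j`. -/
def chordMove (i j : ℕ) (t : ℕ → R) : ℕ → R := fun k =>
  if k = i then t j
  else if k = j then t j ◃⁻¹ t i
  else if i < k ∧ k < j then t j ◃⁻¹ (t i ◃ t k)
  else t k

theorem chordMove_self_succ (i : ℕ) (t : ℕ → R) : chordMove i (i + 1) t = rackMove i t := by
  ext k
  rw [chordMove, rackMove_apply]
  grind

theorem chordMove_rackMove {i j : ℕ} (h : i < j) (t : ℕ → R) :
    chordMove i j (rackMove j t) = rackMove j (chordMove i (j + 1) t) := by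
  have conj (x y z : R) : (z ◃⁻¹ x) ◃⁻¹ (z ◃⁻¹ (x ◃ y)) = z ◃⁻¹ y := by
    rw [← Rack.self_distrib_inv, Rack.invAct_act_eq]
  ext k
  simp only [rackMove_apply, chordMove]
  grind

theorem rackPullback_chordWord (t : ℕ → R) {i j : ℕ} (hij : i < j) (hj : j < n) :
    rackPullback t (chordWord n (i + 1) (j + 1)) = chordMove i j t := by
  induction j, hij using Nat.le_induction generalizing t with
  | base => rw [chordWord_self_succ, rackPullback_sigmaWord t hj, chordMove_self_succ]
  | succ j hij ih =>
    rw [chordWord_succ n (by lia), rackPullback_mul, rackPullback_mul,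
      rackPullback_sigmaWord t hj, ih _ (by lia), chordMove_rackMove hij,
      ← rackPullback_sigmaWord _ hj, rackPullback_mul_inv]

theorem chordMove_cube {Q : Type*} [Quandle Q] (hQ : Rack.IsInvolutory Q) {t : ℕ → Q} {i j : ℕ}
    (hij : i < j) (h : t i ◃ t j = t j ◃ t i) :
    chordMove i j (chordMove i j (chordMove i j t)) = t := by
  have inv (x y : Q) : x ◃⁻¹ y = x ◃ y := Rack.involutory_invAct_eq_act hQ x y
  have act_act (x y : Q) : x ◃ (x ◃ y) = y := hQ x y
  have right_end : (t j ◃ t i) ◃ t j = t i :=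
    calc (t j ◃ t i) ◃ t j = (t i ◃ t j) ◃ (t i ◃ (t i ◃ t j)) := by rw [act_act, h]
      _ = t i ◃ (t j ◃ (t j ◃ t i)) := by rw [← Shelf.self_distrib, h]
      _ = t i := by rw [act_act, Quandle.fix]
  have left_end : t i ◃ (t j ◃ t i) = t j := by rw [← h, act_act]
  ext k
  simp only [chordMove, inv]
  grind

end Chords

/-- The quandle of the reflections of the affine Weyl group of type `A₂` over the abelian group `M`,
under conjugation: `⟨c, x⟩` is the reflection in the line `ℓ_c = x`, where the `ℓ_c`, for
`c : ZMod 3`, are linear forms with `ℓ_0 + ℓ_1 + ℓ_2 = 0`. -/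
@[ext]
structure AffineReflection (M : Type*) where
  /-- The direction of the line. -/
  dir : ZMod 3
  /-- The value of the linear form on the line. -/
  offset : M

namespace AffineReflection

variable {M N : Type*} [AddCommGroup M] [AddCommGroup N]

/-- The conjugate of the second reflection by the first. -/
def conj (p q : AffineReflection M) : AffineReflection M :=
  ⟨-p.dir - q.dir, if p.dir = q.dir then 2 • p.offset - q.offset else -p.offset - q.offset⟩

theorem conj_involutive (p : AffineReflection M) : Function.Involutive p.conj := by
  rintro ⟨e, y⟩
  obtain ⟨c, x⟩ := p
  have dir_same (c : ZMod 3) : -c - c = c := by revert c; decide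
  have dir_third : c ≠ e → c ≠ -c - e := by revert c e; decide
  by_cases h : c = e
  · simp [conj, h, dir_same]
  · simp [conj, h, dir_third h]

theorem conj_conj (p q r : AffineReflection M) :
    p.conj (q.conj r) = (p.conj q).conj (p.conj r) := by
  obtain ⟨c, x⟩ := p
  obtain ⟨d, y⟩ := q
  obtain ⟨e, z⟩ := r
  have dir_eq : -c - (-d - e) = -(-c - d) - (-c - e) := by revert c d e; decide
  have dir_inj : -c - d = -c - e ↔ d = e := by simp
  have dir_same (c : ZMod 3) : -c - c = c := by revert c; decide
  have dir_third : d ≠ e → (c = -d - e ↔ c ≠ d ∧ c ≠ e) := by revert c d e; decide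
  ext
  · exact dir_eq
  · simp only [conj, dir_inj]
    by_cases hde : d = e
    · subst hde
      by_cases hcd : c = d <;> simp [hcd, dir_same] <;> abel
    · by_cases hcd : c = d
      · subst hcd
        simp [hde, dir_third hde]
        abel
      · by_cases hce : c = e
        · subst hce
          simp [hde, hcd, dir_third hde]
          abel
        · simp [hde, hcd, hce, dir_third hde]
          abel

instance : Quandle (AffineReflection M) where
  act := conj
  self_distrib {p q r} := conj_conj p q r
  invAct := conj
  left_inv := conj_involutive
  right_inv := conj_involutive
  fix {p} := by
    have dir_same (c : ZMod 3) : -c - c = c := by revert c; decide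
    ext <;> simp [conj, dir_same, two_smul]

theorem isInvolutory : Rack.IsInvolutory (AffineReflection M) := conj_involutive

theorem invAct_eq_act (p q : AffineReflection M) : p ◃⁻¹ q = p ◃ q := rfl

theorem act_dir (p q : AffineReflection M) : (p ◃ q).dir = -p.dir - q.dir := rfl

theorem act_offset (p q : AffineReflection M) : (p ◃ q).offset =
    if p.dir = q.dir then 2 • p.offset - q.offset else -p.offset - q.offset := rfl

theorem act_of_dir_eq (c : ZMod 3) (x y : M) :
    (⟨c, x⟩ : AffineReflection M) ◃ ⟨c, y⟩ = ⟨c, 2 • x - y⟩ := by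
  have dir_same : -c - c = c := by revert c; decide
  ext <;> simp [act_dir, act_offset, dir_same]

theorem act_of_dir_eq_zmod_two {p q : AffineReflection (ZMod 2)} (h : p.dir = q.dir) :
    p ◃ q = q := by
  obtain ⟨c, x⟩ := p
  obtain ⟨e, y⟩ := q
  obtain rfl : c = e := h
  rw [act_of_dir_eq, two_smul, CharTwo.add_self_eq_zero, zero_sub, CharTwo.neg_eq]

theorem act_comm {p q : AffineReflection M} (h : p.dir ≠ q.dir) : p ◃ q = q ◃ p := by
  ext
  · simp only [act_dir]
    ring
  · simp only [act_offset, if_neg h, if_neg h.symm]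
    abel

/-- The direction of an affine reflection, as a reflection of the linear Weyl group of type `A₂`. -/
def direction : AffineReflection M →◃ Quandle.Dihedral 3 where
  toFun := dir
  map_act' {p q} := show -p.dir - q.dir = 2 * p.dir - q.dir by
    generalize p.dir = c, q.dir = e
    revert c e
    decide

/-- The quandle homomorphism induced by a homomorphism of the coefficient groups. -/
def map (f : M →+ N) : AffineReflection M →◃ AffineReflection N where
  toFun p := ⟨p.dir, f p.offset⟩
  map_act' {p q} := by
    ext
    · rfl
    · simp only [act_offset, apply_ite f, map_sub, map_neg, map_nsmul]

theorem innerAut_affine {g : Equiv.Perm (AffineReflection M)}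
    (hg : g ∈ innerAut (AffineReflection M)) :
    ∃ (η : ℤˣ) (κ : ZMod 3) (m : ZMod 3 → M), ∀ c y, g ⟨c, y⟩ = ⟨η • c + κ, η • y + m c⟩ := by
  induction hg using Subgroup.closure_induction with
  | mem _ hx =>
    obtain ⟨⟨e, x⟩, rfl⟩ := hx
    refine ⟨-1, -e, fun c => if e = c then 2 • x else -x, fun c y => ?_⟩
    ext
    · simp [act_dir]
      ring
    · simp only [Rack.act'_apply, act_offset, Units.neg_smul, one_smul]
      split_ifs <;> abel
  | one => exact ⟨1, 0, 0, by simp⟩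
  | mul g g' _ _ hg hg' =>
    obtain ⟨η, κ, m, h⟩ := hg
    obtain ⟨η', κ', m', h'⟩ := hg'
    refine ⟨η * η', η • κ' + κ, fun c => η • m' c + m (η' • c + κ'), fun c y => ?_⟩
    rw [Equiv.Perm.mul_apply, h', h]
    simp only [smul_add, mul_smul, add_assoc]
  | inv g _ hg =>
    obtain ⟨η, κ, m, h⟩ := hg
    refine ⟨η⁻¹, -(η⁻¹ • κ), fun c => -(η⁻¹ • m (η⁻¹ • c + -(η⁻¹ • κ))), fun c y => ?_⟩
    rw [Equiv.Perm.inv_eq_iff_eq, h]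
    simp only [smul_add, smul_neg, smul_inv_smul, neg_add_cancel_right]

theorem innerAut_translation {g : Equiv.Perm (AffineReflection M)}
    (hg : g ∈ innerAut (AffineReflection M)) {c e : ZMod 3} (hce : c ≠ e) {x y : M}
    (hc : (g ⟨c, x⟩).dir = c) (he : (g ⟨e, y⟩).dir = e) :
    ∃ m : ZMod 3 → M, ∀ c y, g ⟨c, y⟩ = ⟨c, y + m c⟩ := by
  obtain ⟨η, κ, m, h⟩ := innerAut_affine hg
  rw [h] at hc he
  obtain rfl | rfl := Int.units_eq_one_or η
  · obtain rfl : κ = 0 := by simpa using hc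
    exact ⟨m, fun c y => by simp [h]⟩
  · have reflected : c = e := by
      simp only [Units.neg_smul, one_smul] at hc he
      clear h
      revert c e κ
      decide
    exact absurd reflected hce

end AffineReflection

section Offsets

variable {M N : Type*} [AddCommGroup M] [AddCommGroup N] {n : ℕ} {τ : ℕ → ZMod 3}
  {w : FreeGroup (Fin (n - 1))}

/-- The sequence of affine reflections with directions `τ` and offsets `x`. -/
def reflections (τ : ℕ → ZMod 3) (x : ℕ → M) : ℕ → AffineReflection M := fun k => ⟨τ k, x k⟩

/-- The words that fix the sequence `t` of rack elements. -/
def rackStabilizer {R : Type*} [Rack R] (n : ℕ) (t : ℕ → R) :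
    Subgroup (FreeGroup (Fin (n - 1))) where
  carrier := {w | rackPullback t w = t}
  one_mem' := rackPullback_one t
  mul_mem' {v w} hv hw :=
    calc rackPullback t (v * w) = rackPullback (rackPullback t v) w := rackPullback_mul t v w
      _ = rackPullback t w := congrArg (rackPullback · w) hv
      _ = t := hw
  inv_mem' {w} hw :=
    calc rackPullback t w⁻¹ = rackPullback (rackPullback t w) w⁻¹ :=
          congrArg (rackPullback · w⁻¹) (Eq.symm hw)
      _ = t := rackPullback_mul_inv t w

/-- The words that preserve the sequence of directions `τ`. -/
abbrev directionStabilizer (n : ℕ) (τ : ℕ → ZMod 3) : Subgroup (FreeGroup (Fin (n - 1))) :=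
  rackStabilizer (R := Quandle.Dihedral 3) n τ

theorem dir_rackPullback (x : ℕ → M) (w : FreeGroup (Fin (n - 1))) (k : ℕ) :
    (rackPullback (reflections τ x) w k).dir = rackPullback (R := Quandle.Dihedral 3) τ w k :=
  (congrFun (rackPullback_comp AffineReflection.direction (reflections τ x) w) k).symm

theorem rackPullback_reflections_comp (f : M →+ N) (x : ℕ → M) (w : FreeGroup (Fin (n - 1))) :
    rackPullback (reflections τ (f ∘ x)) w =
      AffineReflection.map f ∘ rackPullback (reflections τ x) w :=
  rackPullback_comp (AffineReflection.map f) (reflections τ x) w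

/-- The action of a word on the offsets of sequences of reflections with directions `τ`. It is
additive because the word acts naturally in the coefficient group. -/
def offsetMap (τ : ℕ → ZMod 3) (w : FreeGroup (Fin (n - 1))) : (ℕ → M) →+ (ℕ → M) :=
  AddMonoidHom.mk' (fun x k => (rackPullback (reflections τ x) w k).offset) fun x y => by
    let z : ℕ → M × M := fun k => (x k, y k)
    have hx := rackPullback_reflections_comp (τ := τ) (AddMonoidHom.fst M M) z w
    have hy := rackPullback_reflections_comp (τ := τ) (AddMonoidHom.snd M M) z w
    have hxy := rackPullback_reflections_comp (τ := τ)
      (AddMonoidHom.fst M M + AddMonoidHom.snd M M) z w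
    change rackPullback (reflections τ x) w = _ at hx
    change rackPullback (reflections τ y) w = _ at hy
    change rackPullback (reflections τ (x + y)) w = _ at hxy
    rw [hx, hy, hxy]
    rfl

theorem offsetMap_comp (f : M →+ N) (x : ℕ → M) :
    offsetMap τ w (f ∘ x) = f ∘ offsetMap τ w x :=
  funext fun k => congrArg AffineReflection.offset
    (congrFun (rackPullback_reflections_comp f x w) k)

theorem rackPullback_reflections (hw : w ∈ directionStabilizer n τ) (x : ℕ → M) :
    rackPullback (reflections τ x) w = reflections τ (offsetMap τ w x) :=
  funext fun k => AffineReflection.ext ((dir_rackPullback x w k).trans (congrFun hw k)) rfl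

theorem mem_directionStabilizer {x y : ℕ → M}
    (h : rackPullback (reflections τ x) w = reflections τ y) : w ∈ directionStabilizer n τ :=
  funext fun k => (dir_rackPullback x w k).symm.trans (congrArg AffineReflection.dir (congrFun h k))

theorem offsetMap_eq {x y : ℕ → M} (h : rackPullback (reflections τ x) w = reflections τ y) :
    offsetMap τ w x = y :=
  funext fun k => congrArg AffineReflection.offset (congrFun h k)

/-- The words that preserve the sequence of directions `τ` and the function `q` of the offsets
modulo `2`. -/
def formStabilizer {A : Type*} (n : ℕ) (τ : ℕ → ZMod 3) (q : (ℕ → ZMod 2) → A) :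
    Subgroup (FreeGroup (Fin (n - 1))) where
  carrier := {w | w ∈ directionStabilizer n τ ∧ ∀ x, q (offsetMap τ w x) = q x}
  one_mem' := ⟨one_mem _, fun x => by rw [offsetMap_eq (rackPullback_one _)]⟩
  mul_mem' := by
    rintro v w ⟨hv, hqv⟩ ⟨hw, hqw⟩
    refine ⟨mul_mem hv hw, fun x => ?_⟩
    rw [offsetMap_eq (y := offsetMap τ w (offsetMap τ v x)), hqw, hqv]
    rw [rackPullback_mul, rackPullback_reflections hv, rackPullback_reflections hw]
  inv_mem' := by
    rintro w ⟨hw, hqw⟩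
    refine ⟨inv_mem hw, fun x => ?_⟩
    rw [← hqw (offsetMap τ w⁻¹ x), ← offsetMap_eq (rackPullback_reflections hw _),
      offsetMap_eq (y := x)]
    rw [← rackPullback_reflections (inv_mem hw), rackPullback_inv_mul]

theorem mem_formStabilizer {A : Type*} {q : (ℕ → ZMod 2) → A} (f : (ℕ → ZMod 2) → ℕ → ZMod 2)
    (h : ∀ x, rackPullback (reflections τ x) w = reflections τ (f x)) (hq : ∀ x, q (f x) = q x) :
    w ∈ formStabilizer n τ q :=
  ⟨mem_directionStabilizer (h 0), fun x => by rw [offsetMap_eq (h x), hq]⟩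

theorem mem_formStabilizer_of_fixes {A : Type*} {q : (ℕ → ZMod 2) → A}
    (h : ∀ x : ℕ → ZMod 2, rackPullback (reflections τ x) w = reflections τ x) :
    w ∈ formStabilizer n τ q :=
  mem_formStabilizer id h fun _ => rfl

end Offsets

section QuadraticForm

variable {c : ℕ → ZMod 4} {n : ℕ}

/-- The `ℤ/4`-valued diagonal quadratic form with weights `c` in the first `n` coordinates. -/
def quadForm (c : ℕ → ZMod 4) (n : ℕ) (x : ℕ → ZMod 2) : ZMod 4 :=
  ∑ k ∈ Finset.range n, c k * (x k).val

/-- The embedding of `ℤ/2` into `ℤ/4`. -/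
def doubling : ZMod 2 →+ ZMod 4 := AddMonoidHom.mk' (fun a => 2 * a.val) (by decide)

theorem quadForm_add (hc : ∀ k, 2 * c k = 2) (x y : ℕ → ZMod 2) :
    quadForm c n (x + y) =
      quadForm c n x + quadForm c n y + doubling (∑ k ∈ Finset.range n, x k * y k) := by
  have polarization (a : ZMod 4) (ha : 2 * a = 2) (u v : ZMod 2) :
      a * (u + v).val = a * u.val + a * v.val + doubling (u * v) := by
    revert a u v
    decide
  simp only [quadForm, map_sum, ← Finset.sum_add_distrib]
  exact Finset.sum_congr rfl fun k _ => polarization _ (hc k) _ _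

theorem sum_mul_indicator {s : Finset ℕ} (hs : s ⊆ Finset.range n) (x : ℕ → ZMod 2) :
    ∑ k ∈ Finset.range n, x k * (s : Set ℕ).indicator 1 k = ∑ k ∈ s, x k := by
  rw [← Finset.sum_indicator_subset x hs]
  exact Finset.sum_congr rfl fun k _ => by simp [Set.indicator_apply]

theorem quadForm_indicator {s : Finset ℕ} (hs : s ⊆ Finset.range n) :
    quadForm c n ((s : Set ℕ).indicator 1) = ∑ k ∈ s, c k := by
  rw [← Finset.sum_indicator_subset c hs]
  exact Finset.sum_congr rfl fun k _ => by
    by_cases hk : k ∈ s <;> simp [hk, ZMod.val_one]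

theorem quadForm_transvection (hc : ∀ k, 2 * c k = 2) {s : Finset ℕ} (hs : s ⊆ Finset.range n)
    (hsum : ∑ k ∈ s, c k = 2) (x : ℕ → ZMod 2) :
    quadForm c n (x + (∑ k ∈ s, x k) • (s : Set ℕ).indicator 1) = quadForm c n x := by
  have cases_zmod_two (a : ZMod 2) : a = 0 ∨ a = 1 := by revert a; decide
  obtain h | h := cases_zmod_two (∑ k ∈ s, x k)
  · rw [h, zero_smul, add_zero]
  · have cancel : (2 : ZMod 4) + doubling 1 = 0 := by decide
    rw [h, one_smul, quadForm_add hc, quadForm_indicator hs, sum_mul_indicator hs, h, hsum,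
      add_assoc, cancel, add_zero]

end QuadraticForm

section ModTwo

variable {n : ℕ} {τ : ℕ → ZMod 3} {c : ℕ → ZMod 4}

theorem conj_sigmaWord_sq_mem_formStabilizer {A : Type*} {q : (ℕ → ZMod 2) → A} {i : ℕ}
    (hi : i + 1 < n) (v : FreeGroup (Fin (n - 1)))
    (h : rackPullback (R := Quandle.Dihedral 3) τ v i =
      rackPullback (R := Quandle.Dihedral 3) τ v (i + 1)) :
    v * sigmaWord n (i + 1) ^ 2 * v⁻¹ ∈ formStabilizer n τ q := by
  refine mem_formStabilizer_of_fixes fun x => ?_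
  have same_dir : (rackPullback (reflections τ x) v i).dir =
      (rackPullback (reflections τ x) v (i + 1)).dir := by
    rw [dir_rackPullback, dir_rackPullback]
    exact h
  rw [rackPullback_mul, rackPullback_mul, pow_two, rackPullback_mul, rackPullback_sigmaWord _ hi,
    rackPullback_sigmaWord _ hi, rackMove_sq (AffineReflection.act_of_dir_eq_zmod_two same_dir)
      (AffineReflection.act_of_dir_eq_zmod_two same_dir.symm), rackPullback_mul_inv]

theorem chordWord_cube_mem_formStabilizer {A : Type*} {q : (ℕ → ZMod 2) → A} {i j : ℕ}
    (hij : i < j) (hj : j < n) (h : τ i ≠ τ j) :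
    chordWord n (i + 1) (j + 1) ^ 3 ∈ formStabilizer n τ q := by
  refine mem_formStabilizer_of_fixes fun x => ?_
  rw [pow_three, rackPullback_mul, rackPullback_mul, rackPullback_chordWord _ hij hj,
    rackPullback_chordWord _ hij hj, rackPullback_chordWord _ hij hj]
  exact chordMove_cube AffineReflection.isInvolutory hij (AffineReflection.act_comm h)

/-- The coordinates of the vector in which the half-twist on the chord from `i` to `j` is a
transvection modulo `2`, if the directions at `i` and `j` agree. -/
def chordSupport (τ : ℕ → ZMod 3) (i j : ℕ) : Set ℕ :=
  {k | k = i ∨ k = j ∨ i < k ∧ k < j ∧ τ k ≠ τ i}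

theorem chordMove_reflections_zmod_two {i j : ℕ} (h : τ i = τ j) (x : ℕ → ZMod 2) :
    chordMove i j (reflections τ x) =
      reflections τ (x + (x i + x j) • (chordSupport τ i j).indicator 1) := by
  have between (c e : ZMod 3) (u v y : ZMod 2) :
      (⟨c, v⟩ : AffineReflection (ZMod 2)) ◃⁻¹ (⟨c, u⟩ ◃ ⟨e, y⟩) =
        ⟨e, y + if e = c then 0 else u + v⟩ := by
    rw [AffineReflection.ext_iff]
    revert c e u v y
    decide
  have cancel (u v : ZMod 2) : u + (u + v) = v ∧ v + (u + v) = u := by revert u v; decide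
  ext k : 1
  simp only [chordMove, reflections, ← h]
  by_cases hi : k = i
  · simp [hi, h, chordSupport, cancel]
  by_cases hj : k = j
  · subst hj
    simp [hi, ← h, chordSupport, cancel, AffineReflection.invAct_eq_act,
      AffineReflection.act_of_dir_eq_zmod_two]
  by_cases hk : i < k ∧ k < j
  · by_cases hτ : τ k = τ i <;> simp [hi, hj, hk, hτ, between, chordSupport]
  · simp [hi, hj, hk, chordSupport, ← and_assoc]

theorem sigmaWord_mem_formStabilizer (hc : ∀ k, 2 * c k = 2) {i : ℕ} (hi : i + 1 < n)
    (hτ : τ i = τ (i + 1)) (hci : c i = c (i + 1)) :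
    sigmaWord n (i + 1) ∈ formStabilizer n τ (quadForm c n) := by
  have support : chordSupport τ i (i + 1) = ({i, i + 1} : Finset ℕ) := by
    ext k
    simp only [chordSupport, Set.mem_ofPred_eq, Finset.coe_insert, Finset.coe_singleton,
      Set.mem_insert_iff, Set.mem_singleton_iff]
    lia
  refine mem_formStabilizer _ (fun x => ?_)
    (quadForm_transvection hc (s := {i, i + 1}) (by grind) ?_)
  · rw [rackPullback_sigmaWord _ hi, ← chordMove_self_succ, chordMove_reflections_zmod_two hτ,
      support, Finset.sum_pair (by lia)]
  · rw [Finset.sum_pair (by lia), ← hci, ← two_mul, hc]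

end ModTwo

section ArcS

variable {n a l : ℕ} {c : ℕ → ZMod 4}

/-- The sequence of directions that is `0` at the first `m` positions and `1` at the others. -/
def blockDirection (m k : ℕ) : ZMod 3 := if k < m then 0 else 1

/-- The directions after the half-twists on the chords from `a` to `a + 1` and from `0` to `l`, for
the initial directions `blockDirection (a + 1)`. -/
def twistedDirection (a l k : ℕ) : ZMod 3 :=
  if k = 0 then 1 else if k < a then 2 else if k = a then 0 else if k = a + 1 then 1
  else if k < l then 0 else if k = l then 2 else 1

/-- The offsets modulo `2` that go with `twistedDirection a l`, for the initial offsets `x`. -/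
def twistedOffset (a l : ℕ) (x : ℕ → ZMod 2) (k : ℕ) : ZMod 2 :=
  if k = 0 then x l else if k < a then x l + x k else if k = a then x 0 + x l + x (a + 1)
  else if k = a + 1 then x 0 + (x a + x (a + 1)) else if k < l then x 0 + x l + x k
  else if k = l then x 0 + x l else x k

theorem chordMove_rackMove_reflections (ha : 0 < a) (hl : a + 1 < l) (x : ℕ → ZMod 2) :
    chordMove 0 l (rackMove a (reflections (blockDirection (a + 1)) x)) =
      reflections (twistedDirection a l) (twistedOffset a l x) := by
  have conj_end (u v : ZMod 2) :
      (⟨1, v⟩ : AffineReflection (ZMod 2)) ◃⁻¹ ⟨0, u⟩ = ⟨2, u + v⟩ := by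
    rw [AffineReflection.ext_iff]
    revert u v
    decide
  have inner (k : ℕ) : rackMove a (reflections (blockDirection (a + 1)) x) k =
      if k < a then ⟨0, x k⟩ else if k = a then ⟨1, x (a + 1)⟩
      else if k = a + 1 then ⟨2, x a + x (a + 1)⟩ else ⟨1, x k⟩ := by
    simp only [rackMove_apply, reflections, blockDirection]
    grind
  have conj_between (u v y : ZMod 2) :
      (⟨1, v⟩ : AffineReflection (ZMod 2)) ◃⁻¹ (⟨0, u⟩ ◃ ⟨0, y⟩) = ⟨2, v + y⟩ ∧
      (⟨1, v⟩ : AffineReflection (ZMod 2)) ◃⁻¹ (⟨0, u⟩ ◃ ⟨1, y⟩) = ⟨0, u + v + y⟩ ∧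
      (⟨1, v⟩ : AffineReflection (ZMod 2)) ◃⁻¹ (⟨0, u⟩ ◃ ⟨2, y⟩) = ⟨1, u + y⟩ := by
    simp only [AffineReflection.ext_iff]
    revert u v y
    decide
  ext k : 1
  simp only [chordMove, inner, reflections, twistedDirection, twistedOffset]
  grind

theorem twistedOffset_add_indicator (ha : 0 < a) (hl : a + 1 < l) (x : ℕ → ZMod 2) (S : ZMod 2) :
    twistedOffset a l (x + S • (({0, a, a + 1, l} : Finset ℕ) : Set ℕ).indicator 1) =
      twistedOffset a l x +
        S • (chordSupport (twistedDirection a l) 0 (a + 1)).indicator 1 := by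
  ext k
  simp only [twistedDirection, twistedOffset, chordSupport, Set.indicator_apply, Pi.add_apply,
    Pi.smul_apply, Pi.one_apply, smul_eq_mul, Finset.mem_coe, Finset.mem_insert,
    Finset.mem_singleton, Set.mem_ofPred_eq]
  have one_ne : (1 : ZMod 3) ≠ 0 ∧ (1 : ZMod 3) ≠ 2 := by decide
  grind [CharTwo.add_self_eq_zero S]

theorem arcS_word_mem_formStabilizer (ha : 0 < a) (hl : a + 1 < l) (hn : l < n)
    (hc : ∀ k, 2 * c k = 2) (hsum : c 0 + c a + c (a + 1) + c l = 2) :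
    (chordWord n (a + 1) (a + 2) * chordWord n 1 (l + 1)) * chordWord n 1 (a + 2) *
        (chordWord n (a + 1) (a + 2) * chordWord n 1 (l + 1))⁻¹ ∈
      formStabilizer n (blockDirection (a + 1)) (quadForm c n) := by
  have sum_corners {A : Type} [AddCommMonoid A] (f : ℕ → A) :
      ∑ k ∈ ({0, a, a + 1, l} : Finset ℕ), f k = f 0 + f a + f (a + 1) + f l := by
    rw [Finset.sum_insert (by grind), Finset.sum_insert (by grind), Finset.sum_pair (by lia)]
    simp only [add_assoc]
  have pullback_outer (x : ℕ → ZMod 2) :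
      rackPullback (reflections (blockDirection (a + 1)) x)
          (chordWord n (a + 1) (a + 2) * chordWord n 1 (l + 1)) =
        reflections (twistedDirection a l) (twistedOffset a l x) := by
    rw [rackPullback_mul, rackPullback_chordWord _ (lt_add_one a) (by lia), chordMove_self_succ,
      rackPullback_chordWord _ (by lia) hn, chordMove_rackMove_reflections ha hl]
  have ends_dir : twistedDirection a l 0 = twistedDirection a l (a + 1) := by
    grind [twistedDirection]
  have ends_offset (x : ℕ → ZMod 2) : twistedOffset a l x 0 + twistedOffset a l x (a + 1) =
      ∑ k ∈ ({0, a, a + 1, l} : Finset ℕ), x k := by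
    rw [sum_corners]
    grind [twistedOffset]
  refine mem_formStabilizer _ (fun x => ?_)
    (quadForm_transvection hc (s := {0, a, a + 1, l}) (by grind) (by rw [sum_corners, hsum]))
  rw [rackPullback_mul, rackPullback_mul, pullback_outer,
    rackPullback_chordWord _ (by lia) (by lia),
    chordMove_reflections_zmod_two ends_dir, ends_offset,
    ← twistedOffset_add_indicator ha hl, ← pullback_outer, rackPullback_mul_inv]

end ArcS

section Monodromy

variable {b d : ℕ}

/-- The transposition in `𝔖₄` that corresponds to an affine reflection modulo `2`: the affine Weyl
group of type `A₂` modulo twice its translations is `𝔖₄`. -/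
def transposition : AffineReflection (ZMod 2) →◃ Quandle.Conj (Equiv.Perm (Fin 4)) where
  toFun p :=
    if p.dir = 0 then (if p.offset = 0 then Equiv.swap 2 3 else Equiv.swap 0 1)
    else if p.dir = 1 then (if p.offset = 0 then Equiv.swap 0 2 else Equiv.swap 1 3)
    else (if p.offset = 0 then Equiv.swap 0 3 else Equiv.swap 1 2)
  map_act' {p q} := by
    obtain ⟨c, x⟩ := p
    obtain ⟨e, y⟩ := q
    simp only [AffineReflection.act_dir, AffineReflection.act_offset, Quandle.conj_act_eq_conj]
    revert c x e y
    decide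

theorem dir_eq_of_disjoint_transposition {p q : AffineReflection (ZMod 2)}
    (h : Equiv.Perm.Disjoint (transposition p : Equiv.Perm (Fin 4)) (transposition q)) :
    p.dir = q.dir := by
  obtain ⟨c, x⟩ := p
  obtain ⟨e, y⟩ := q
  revert c x e y
  unfold Equiv.Perm.Disjoint
  decide

theorem coverMonodromy_eq (b d : ℕ) : coverMonodromy b d = fun k : Fin (numPts b d) =>
    (transposition (reflections (blockDirection (4 * d))
      (fun k => if k < 2 * d ∨ (4 * d ≤ k ∧ k < 4 * d + 2 * b) then 0 else 1) k) :
        Equiv.Perm (Fin 4)) := by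
  ext1 k
  change _ = if _ then (if _ then _ else _) else _
  grind [coverMonodromy, reflections, blockDirection]

/-- The weights of the invariant quadratic form: `3` at the points `B'_i` and `1` at all others. -/
def pointWeight (b d k : ℕ) : ZMod 4 := if 4 * d ≤ k ∧ k < 4 * d + 2 * b then 3 else 1

theorem two_mul_pointWeight (b d k : ℕ) : 2 * pointWeight b d k = 2 := by
  unfold pointWeight
  split_ifs <;> decide

/-- The words that preserve the directions at the marked points and the invariant quadratic form. -/
abbrev monodromyStabilizer (b d : ℕ) : Subgroup (FreeGroup (Fin (numPts b d - 1))) :=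
  formStabilizer (numPts b d) (blockDirection (4 * d)) (quadForm (pointWeight b d) (numPts b d))

theorem admissibleFullTwists_subset (b d : ℕ) :
    admissibleFullTwists b d ⊆ ((monodromyStabilizer b d).map
      (PresentedGroup.mk (sphereBraidRels (numPts b d))) : Set (SphereBraid (numPts b d))) := by
  rintro _ ⟨w, i, disjoint, rfl⟩
  have hi : (i : ℕ) + 1 < numPts b d := by lia
  have mk_generator : PresentedGroup.mk (sphereBraidRels (numPts b d))
      (sigmaWord (numPts b d) (i + 1)) = PresentedGroup.of i := by
    rw [mk_sigmaWord, sigma, dif_pos (by lia)]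
    rfl
  have same_dir := dir_eq_of_disjoint_transposition (by
    rw [coverMonodromy_eq, pullback_conj, pullback_conj] at disjoint
    exact disjoint)
  rw [dir_rackPullback, dir_rackPullback] at same_dir
  refine ⟨_, conj_sigmaWord_sq_mem_formStabilizer hi w same_dir, ?_⟩
  rw [map_mul, map_mul, map_inv, map_pow, mk_generator]

theorem chordTwist_mem_of_adjacent {i j : ℕ} (k : ℕ) (hi : i = k + 1) (hj : j = k + 2)
    (hk : k + 1 < numPts b d)
    (hdir : blockDirection (4 * d) k = blockDirection (4 * d) (k + 1))
    (hweight : pointWeight b d k = pointWeight b d (k + 1)) :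
    chordTwist (numPts b d) i j ∈ (monodromyStabilizer b d).map (PresentedGroup.mk _) := by
  subst hi hj
  refine ⟨_, sigmaWord_mem_formStabilizer (two_mul_pointWeight b d) hk hdir hweight, ?_⟩
  rw [← mk_chordWord, chordWord_self_succ]

theorem chordTwist_sq_mem_of_adjacent {i j : ℕ} (k : ℕ) (hi : i = k + 1) (hj : j = k + 2)
    (hk : k + 1 < numPts b d)
    (hdir : blockDirection (4 * d) k = blockDirection (4 * d) (k + 1)) :
    chordTwist (numPts b d) i j ^ 2 ∈ (monodromyStabilizer b d).map (PresentedGroup.mk _) := by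
  subst hi hj
  have fixed := rackPullback_one (n := numPts b d) (R := Quandle.Dihedral 3)
    (blockDirection (4 * d))
  refine ⟨_, conj_sigmaWord_sq_mem_formStabilizer hk 1
    ((congrFun fixed k).trans (hdir.trans (congrFun fixed (k + 1)).symm)), ?_⟩
  rw [one_mul, inv_one, mul_one, map_pow, ← chordWord_self_succ, mk_chordWord]

theorem chordTwist_cube_mem {i j : ℕ} (hi : 1 ≤ i) (hid : i ≤ 4 * d) (hdj : 4 * d < j)
    (hj : j ≤ numPts b d) :
    chordTwist (numPts b d) i j ^ 3 ∈ (monodromyStabilizer b d).map (PresentedGroup.mk _) := by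
  obtain ⟨i, rfl⟩ := Nat.exists_eq_add_of_le' hi
  obtain ⟨j, rfl⟩ := Nat.exists_eq_add_of_le' (show 1 ≤ j by lia)
  refine ⟨_, chordWord_cube_mem_formStabilizer (i := i) (j := j) (by lia) (by lia) ?_, ?_⟩
  · rw [blockDirection, blockDirection, if_pos (by lia), if_neg (by lia)]
    decide
  · rw [map_pow, mk_chordWord]

theorem twistS_mem (hb : 1 ≤ b) (hd : 1 ≤ d) :
    twistS b d ∈ (monodromyStabilizer b d).map (PresentedGroup.mk _) := by
  obtain ⟨a, ha⟩ : ∃ a, 4 * d = a + 1 := Nat.exists_eq_add_of_le' (by lia)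
  obtain ⟨l, hl⟩ : ∃ l, numPts b d = l + 1 := Nat.exists_eq_add_of_le' (by lia)
  have weights : pointWeight b d 0 + pointWeight b d a + pointWeight b d (a + 1) +
      pointWeight b d l = 2 := by
    have : pointWeight b d 0 = 1 ∧ pointWeight b d a = 1 ∧ pointWeight b d (a + 1) = 3 ∧
      pointWeight b d l = 1 := by grind [pointWeight]
    grind
  refine ⟨_, ha ▸ arcS_word_mem_formStabilizer (a := a) (l := l) (by lia) (by lia) (by lia)
    (two_mul_pointWeight b d) weights, ?_⟩
  simp only [map_mul, map_inv, mk_chordWord, twistS, twistU', twistU'', twistU, ptD', ptB',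
    ptD'', ptB'', Nat.add_sub_cancel, ha, ← hl]

theorem stabilizedMonodromyGroup_le (hb : 1 ≤ b) (hd : 1 ≤ d) :
    stabilizedMonodromyGroup b d ≤ (monodromyStabilizer b d).map (PresentedGroup.mk _) := by
  rw [stabilizedMonodromyGroup, Subgroup.closure_le, Set.union_subset_iff]
  refine ⟨?_, admissibleFullTwists_subset b d⟩
  rintro _ ((⟨i, hi, hi', rfl | rfl⟩ | ⟨j, hj, hj', rfl | rfl⟩) | rfl | rfl | rfl | rfl | rfl)
  · apply chordTwist_mem_of_adjacent (4 * d + i - 1) <;>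
      grind [ptB', blockDirection, pointWeight]
  · apply chordTwist_mem_of_adjacent (numPts b d - i - 1) <;>
      grind [ptB'', blockDirection, pointWeight]
  · apply chordTwist_mem_of_adjacent (4 * d - j - 1) <;>
      grind [ptD', blockDirection, pointWeight]
  · apply chordTwist_mem_of_adjacent (j - 1) <;> grind [ptD'', blockDirection, pointWeight]
  · apply chordTwist_sq_mem_of_adjacent (4 * d + 2 * b - 1) <;>
      grind [ptB', ptB'', blockDirection]
  · apply chordTwist_sq_mem_of_adjacent (2 * d - 1) <;> grind [ptD', ptD'', blockDirection]
  · exact twistS_mem hb hd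
  · apply chordTwist_cube_mem <;> grind [ptD', ptB']
  · apply chordTwist_cube_mem <;> grind [ptD'', ptB'']
end Monodromy

section FullTwists

variable {M : Type*} [AddCommGroup M] {n i j : ℕ} {τ : ℕ → ZMod 3}

/-- The vector by multiples of which the half-twist on the chord from `i` to `j` changes
the offsets, if all directions from `i` to `j` agree. -/
def chordClass (i j k : ℕ) : ℤ := if k = i ∨ k = j then 1 else if i < k ∧ k < j then 2 else 0

theorem intCast_comp_chordClass (i j : ℕ) :
    Int.castAddHom (ZMod 2) ∘ chordClass i j = (({i, j} : Finset ℕ) : Set ℕ).indicator 1 := by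
  have cast_two : (2 : ZMod 2) = 0 := CharTwo.two_eq_zero
  ext k
  by_cases h : k = i ∨ k = j
  · simp [chordClass, h]
  · by_cases hk : i < k ∧ k < j <;> simp [chordClass, h, hk, cast_two]

theorem chordMove_reflections (hij : i < j) (hτ : ∀ k, i ≤ k → k ≤ j → τ k = τ i) (x : ℕ → M) :
    chordMove i j (reflections τ x) =
      reflections τ fun k => x k + chordClass i j k • (x j - x i) := by
  ext k : 1
  simp only [chordMove, reflections, chordClass]
  rw [hτ j hij.le le_rfl]
  by_cases hi : k = i
  · simp [hi]
  by_cases hj : k = j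
  · subst hj
    simp only [hi, if_true, if_false, or_true, hτ k hij.le le_rfl, AffineReflection.invAct_eq_act,
      AffineReflection.act_of_dir_eq]
    congr 1
    abel
  by_cases hk : i < k ∧ k < j
  · simp only [hi, hj, hk, and_self, if_true, if_false, or_self, hτ k hk.1.le hk.2.le,
      AffineReflection.invAct_eq_act, AffineReflection.act_of_dir_eq]
    congr 1
    abel
  · simp [hi, hj, hk]

theorem rackPullback_chordWord_sq (hij : i < j) (hj : j < n)
    (hτ : ∀ k, i ≤ k → k ≤ j → τ k = τ i) (x : ℕ → M) :
    rackPullback (reflections τ x) (chordWord n (i + 1) (j + 1) ^ 2) =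
      reflections τ fun k => x k + (2 * chordClass i j k) • (x j - x i) := by
  have ends : chordClass i j i = 1 ∧ chordClass i j j = 1 := by simp [chordClass]
  rw [pow_two, rackPullback_mul, rackPullback_chordWord _ hij hj, rackPullback_chordWord _ hij hj,
    chordMove_reflections hij hτ, chordMove_reflections hij hτ]
  congr 1
  ext k
  rw [ends.1, ends.2, one_smul, add_sub_add_right_eq_sub, add_assoc, ← add_smul,
    ← two_mul]

theorem InnerEquiv.exists_eq_add {x y : ℕ → M}
    (h : InnerEquiv n (reflections τ x) (reflections τ y)) (hi : i < n) (hj : j < n)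
    (hτ : τ i ≠ τ j) : ∃ m : ZMod 3 → M, ∀ k < n, y k = x k + m (τ k) := by
  obtain ⟨g, hg, hgt⟩ := h
  obtain ⟨m, hm⟩ := AffineReflection.innerAut_translation hg hτ
    (congrArg AffineReflection.dir (hgt i hi)).symm (congrArg AffineReflection.dir (hgt j hj)).symm
  exact ⟨m, fun k hk => congrArg AffineReflection.offset ((hgt k hk).trans (hm _ _))⟩

theorem exists_offsetMap_chordClass_eq {w : FreeGroup (Fin (n - 1))} {i' j' : ℕ}
    (hw : w ∈ directionStabilizer n τ) (hij : i < j) (hj : j < n)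
    (hτ : ∀ k, i ≤ k → k ≤ j → τ k = τ i) (hij' : i' < j') (hj' : j' < n)
    (hτ' : ∀ k, i' ≤ k → k ≤ j' → τ k = τ i') (hne : τ i ≠ τ i') {x : ℕ → ℤ}
    (hx : rackProd (reflections τ x) 0 n = 1) (hxij : x j - x i = 1)
    (h : PresentedGroup.mk (sphereBraidRels n) (w * chordWord n (i' + 1) (j' + 1) ^ 2) =
      PresentedGroup.mk (sphereBraidRels n) (chordWord n (i + 1) (j + 1) ^ 2 * w)) :
    ∃ (l : ℤ) (p : ZMod 3 → ℤ),
      ∀ k < n, offsetMap τ w (chordClass i j) k = l * chordClass i' j' k + p (τ k) := by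
  have twisted : (fun k => x k + (2 * chordClass i j k) • (x j - x i)) =
      x + (2 : ℕ) • chordClass i j := by
    ext k
    simp [hxij]
  have equiv := innerEquiv_of_mk_eq h hx
  rw [rackPullback_mul, rackPullback_mul, rackPullback_reflections hw,
    rackPullback_chordWord_sq hij' hj' hτ', rackPullback_chordWord_sq hij hj hτ, twisted,
    rackPullback_reflections hw, map_add, map_nsmul] at equiv
  obtain ⟨m, hm⟩ := equiv.exists_eq_add (hij.trans hj) (hij'.trans hj') hne
  refine ⟨offsetMap τ w x j' - offsetMap τ w x i', fun c => m c / 2, fun k hk => ?_⟩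
  have hmk := hm k hk
  simp only [two_nsmul, Pi.add_apply, smul_eq_mul] at hmk
  have hm_even : m (τ k) = 2 * (offsetMap τ w (chordClass i j) k -
      (offsetMap τ w x j' - offsetMap τ w x i') * chordClass i' j' k) := by linear_combination -hmk
  change _ = _ + m (τ k) / 2
  rw [hm_even, Int.mul_ediv_cancel_left _ two_ne_zero]
  ring

end FullTwists

section Distinction

variable {b d : ℕ}

theorem rackProd_eq_one_of_const {Q : Type*} [Rack Q] (hQ : Rack.IsInvolutory Q) {t : ℕ → Q}
    {q : Q} {a m : ℕ} (h : ∀ k, a ≤ k → k < a + 2 * m → t k = q) :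
    rackProd t a (a + 2 * m) = 1 := by
  induction m with
  | zero => exact rackProd_self t a
  | succ m ih =>
    have last : rackProd t (a + 2 * m) (a + 2 * (m + 1)) = 1 := by
      rw [rackProd_eq_mul _ (by lia), rackProd_eq_mul _ (by lia), show a + 2 * m + 1 + 1 =
        a + 2 * (m + 1) by ring, rackProd_self, h _ (by lia) (by lia), h _ (by lia) (by lia),
        mul_one]
      exact Equiv.ext (hQ q)
    rw [← rackProd_mul_rackProd t (b := a + 2 * m) (by lia) (by lia), last,
      ih fun k hk hk' => h k hk (by lia), one_mul]

/-- The offsets `1` at the points `D'_j` and `0` at all others. -/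
def upperOffset (d k : ℕ) : ℤ := if 2 * d ≤ k ∧ k < 4 * d then 1 else 0

theorem rackProd_upperOffset (b d : ℕ) :
    rackProd (reflections (blockDirection (4 * d)) (upperOffset d)) 0 (numPts b d) = 1 := by
  have lower : rackProd (reflections (blockDirection (4 * d)) (upperOffset d)) 0 (0 + 2 * d) = 1 :=
    rackProd_eq_one_of_const AffineReflection.isInvolutory (q := ⟨0, 0⟩) fun k _ hk => by
      rw [reflections, blockDirection, upperOffset, if_pos (by lia), if_neg (by lia)]
  have upper : rackProd (reflections (blockDirection (4 * d)) (upperOffset d)) (0 + 2 * d)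
      (0 + 2 * d + 2 * d) = 1 :=
    rackProd_eq_one_of_const AffineReflection.isInvolutory (q := ⟨0, 1⟩) fun k hk hk' => by
      rw [reflections, blockDirection, upperOffset, if_pos (by lia), if_pos (by lia)]
  have right : rackProd (reflections (blockDirection (4 * d)) (upperOffset d)) (0 + 2 * d + 2 * d)
      (0 + 2 * d + 2 * d + 2 * (2 * b)) = 1 :=
    rackProd_eq_one_of_const AffineReflection.isInvolutory (q := ⟨1, 0⟩) fun k hk _ => by
      rw [reflections, blockDirection, upperOffset, if_neg (by lia), if_neg (by lia)]
  rw [show numPts b d = 0 + 2 * d + 2 * d + 2 * (2 * b) by ring,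
    ← rackProd_mul_rackProd _ (b := 0 + 2 * d + 2 * d) (by lia) (by lia), right,
    ← rackProd_mul_rackProd _ (b := 0 + 2 * d) (by lia) (by lia), lower, upper, one_mul, one_mul]

theorem quadForm_comp_blockDirection (b d : ℕ) (p : ZMod 3 → ZMod 2) :
    quadForm (pointWeight b d) (numPts b d) (p ∘ blockDirection (4 * d)) = 0 := by
  have left : ∀ k ∈ Finset.range (4 * d),
      pointWeight b d k * ((p ∘ blockDirection (4 * d)) k).val = (p 0).val := fun k hk => by
    grind [pointWeight, blockDirection]
  have upper : ∀ k ∈ Finset.range (2 * b), pointWeight b d (4 * d + k) *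
      ((p ∘ blockDirection (4 * d)) (4 * d + k)).val = 3 * (p 1).val := fun k hk => by
    grind [pointWeight, blockDirection]
  have lower : ∀ k ∈ Finset.range (2 * b), pointWeight b d (4 * d + 2 * b + k) *
      ((p ∘ blockDirection (4 * d)) (4 * d + 2 * b + k)).val = (p 1).val := fun k _ => by
    grind [pointWeight, blockDirection]
  have four_eq_zero : (4 : ZMod 4) = 0 := rfl
  rw [quadForm, show numPts b d = 4 * d + 2 * b + 2 * b by ring, Finset.sum_range_add,
    Finset.sum_range_add, Finset.sum_congr rfl left, Finset.sum_congr rfl upper,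
    Finset.sum_congr rfl lower]
  simp only [Finset.sum_const, Finset.card_range, nsmul_eq_mul]
  push_cast
  linear_combination ((d : ZMod 4) * (p 0).val + 2 * b * (p 1).val) * four_eq_zero

theorem quadForm_smul_indicator_add_comp_blockDirection {i j : ℕ} (hi : 4 * d ≤ i)
    (hi' : i < 4 * d + 2 * b) (hj : 4 * d + 2 * b ≤ j) (hj' : j < numPts b d) (l : ZMod 2)
    (p : ZMod 3 → ZMod 2) :
    quadForm (pointWeight b d) (numPts b d)
      (l • (({i, j} : Finset ℕ) : Set ℕ).indicator 1 + p ∘ blockDirection (4 * d)) = 0 := by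
  have cases_zmod_two (a : ZMod 2) : a = 0 ∨ a = 1 := by revert a; decide
  have support : ({i, j} : Finset ℕ) ⊆ Finset.range (numPts b d) := by grind
  obtain rfl | rfl := cases_zmod_two l
  · rw [zero_smul, zero_add, quadForm_comp_blockDirection]
  · have weights : pointWeight b d i + pointWeight b d j = 0 := by
      rw [pointWeight, pointWeight, if_pos (by lia), if_neg (by lia)]
      decide
    have same_block : (p ∘ blockDirection (4 * d)) i = (p ∘ blockDirection (4 * d)) j := by
      grind [blockDirection]
    rw [one_smul, add_comm, quadForm_add (two_mul_pointWeight b d), quadForm_comp_blockDirection,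
      quadForm_indicator support, Finset.sum_pair (by lia), weights, sum_mul_indicator support,
      Finset.sum_pair (by lia), same_block, CharTwo.add_self_eq_zero (R := ZMod 2), map_zero,
      add_zero, add_zero]

theorem quadForm_chordClass_of_lt {i j : ℕ} (hij : i < j) (hj : j < 4 * d) :
    quadForm (pointWeight b d) (numPts b d) (Int.castAddHom (ZMod 2) ∘ chordClass i j) = 2 := by
  rw [intCast_comp_chordClass, quadForm_indicator (by grind), Finset.sum_pair hij.ne, pointWeight,
    pointWeight, if_neg (by lia), if_neg (by lia)]
  decide

theorem mul_twistP_sq_ne {i j : ℕ} (hi : 1 ≤ i) (hi' : i ≤ 2 * b) (hj : 1 ≤ j) (hj' : j ≤ 2 * d)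
    {h : SphereBraid (numPts b d)} (hh : h ∈ stabilizedMonodromyGroup b d) :
    h * twistP b d i ^ 2 ≠ twistQ b d j ^ 2 * h := by
  intro conj
  obtain ⟨w, ⟨hw, hq⟩, rfl⟩ := stabilizedMonodromyGroup_le (by lia) (by lia) hh
  have ends_P : ptB' d i = 4 * d + i - 1 + 1 ∧ ptB'' b d i = numPts b d - i + 1 := by
    grind [ptB', ptB'']
  have ends_Q : ptD'' j = j - 1 + 1 ∧ ptD' d j = 4 * d - j + 1 := by grind [ptD'', ptD']
  rw [twistP, twistQ, ends_P.1, ends_P.2, ends_Q.1, ends_Q.2, ← mk_chordWord, ← mk_chordWord,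
    ← map_pow, ← map_pow, ← map_mul, ← map_mul] at conj
  obtain ⟨l, p, offsets⟩ := exists_offsetMap_chordClass_eq hw (by lia) (by lia)
    (by grind [blockDirection]) (by lia) (by lia) (by grind [blockDirection])
    (by rw [blockDirection, blockDirection, if_pos (by lia), if_neg (by lia)]; decide)
    (rackProd_upperOffset b d) (by grind [upperOffset]) conj
  have form_eq := hq (Int.castAddHom (ZMod 2) ∘ chordClass (j - 1) (4 * d - j))
  rw [offsetMap_comp] at form_eq
  have offsets_mod_two : quadForm (pointWeight b d) (numPts b d) (Int.castAddHom (ZMod 2) ∘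
      offsetMap (blockDirection (4 * d)) w (chordClass (j - 1) (4 * d - j))) =
      quadForm (pointWeight b d) (numPts b d)
        ((l : ZMod 2) • (({4 * d + i - 1, numPts b d - i} : Finset ℕ) : Set ℕ).indicator 1 +
          (Int.castAddHom (ZMod 2) ∘ p) ∘ blockDirection (4 * d)) := by
    rw [← intCast_comp_chordClass]
    refine Finset.sum_congr rfl fun k hk => ?_
    simp [offsets k (Finset.mem_range.mp hk)]
  rw [offsets_mod_two, quadForm_smul_indicator_add_comp_blockDirection (by lia) (by lia) (by lia)
    (by lia), quadForm_chordClass_of_lt (by lia) (by lia)] at form_eq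
  exact absurd form_eq (by decide)

end Distinction

end BidoubleBraid

theorem mainTheorem4_general (b d i j : ℕ) (hi : 1 ≤ i) (hi' : i ≤ 2 * b) (hj : 1 ≤ j)
    (hj' : j ≤ 2 * d) :
    (¬ ∃ h ∈ BidoubleBraid.stabilizedMonodromyGroup b d,
      h * BidoubleBraid.twistP b d i = BidoubleBraid.twistQ b d j * h) ∧
    (¬ ∃ h ∈ BidoubleBraid.monodromyGroup b d,
      h * BidoubleBraid.twistP b d i ^ 2 * h⁻¹ = BidoubleBraid.twistQ b d j ^ 2) ∧
    (¬ ∃ h ∈ BidoubleBraid.stabilizedMonodromyGroup b d,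
      h * BidoubleBraid.twistP b d i ^ 2 * h⁻¹ = BidoubleBraid.twistQ b d j ^ 2) := by
  have full_twists : ¬ ∃ h ∈ BidoubleBraid.stabilizedMonodromyGroup b d,
      h * BidoubleBraid.twistP b d i ^ 2 * h⁻¹ = BidoubleBraid.twistQ b d j ^ 2 := by
    rintro ⟨h, hh, conj⟩
    exact BidoubleBraid.mul_twistP_sq_ne hi hi' hj hj' hh (mul_inv_eq_iff_eq_mul.mp conj)
  refine ⟨?_, ?_, full_twists⟩
  · rintro ⟨h, hh, conj⟩
    refine full_twists ⟨h, hh, ?_⟩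
    rw [← conj_pow, mul_inv_eq_of_eq_mul conj]
  · rintro ⟨h, hh, conj⟩
    exact full_twists ⟨h, Subgroup.closure_mono Set.subset_union_left hh, conj⟩

theorem mainTheorem4 (b d : ℕ) (hb : 3 ≤ b) (hd : 3 ≤ d)
    (i j : ℕ) (hi : 1 ≤ i) (hi' : i ≤ 2 * b) (hj : 1 ≤ j) (hj' : j ≤ 2 * d) :
    (¬ ∃ h ∈ BidoubleBraid.stabilizedMonodromyGroup b d,
      h * BidoubleBraid.twistP b d i = BidoubleBraid.twistQ b d j * h) ∧
    (¬ ∃ h ∈ BidoubleBraid.monodromyGroup b d,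
      h * BidoubleBraid.twistP b d i ^ 2 * h⁻¹ = BidoubleBraid.twistQ b d j ^ 2) ∧
    (¬ ∃ h ∈ BidoubleBraid.stabilizedMonodromyGroup b d,
      h * BidoubleBraid.twistP b d i ^ 2 * h⁻¹ = BidoubleBraid.twistQ b d j ^ 2) :=
  mainTheorem4_general b d i j hi hi' hj hj'
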